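/- **Theorem (Neighborhood diversity).** *Setting.* Let $G$ be an undirected graph without self-loops on the node set $[k]=\{1,\dots,k\}$, and let $\nu_v\in\{0,1\}^k$ be the characteristic vector of the neighborhood $N(v)$ of node $v$, and $e_v\in\{0,1\}^k$ that of $\{v\}$. Nodes $u,v$ are *false twins* if they are not adjacent and $N(u)=N(v)$, and *true twins* if they are adjacent and $N(u)\cup\{u\}=N(v)\cup\{v\}$; they are *twins* if they are false or true twins. The *neighborhood diversity* of $G$ is the least $d$ such that the nodes of $G$ can be partitioned into $d$ nonempty sets, in each of which all nodes are twins of one another. In the quantum NIH (number-in-hand) network model there is one player per node $v\in[k]$, whose input is $\nu_v$. Each player sends to a referee a quantum state that depends only on its own input (without shared randomness or shared entanglement), and the referee measures the received product state and outputs a value. The communication cost is the total number of qubits sent. The protocol is *bounded-error* for a graph parameter if on every graph $G$ it outputs the correct value with probability at least $2/3$. A *modified equality query* $\mathrm{MEQ}_{k,k}(i,j,y,z)$, with $i,j\in[k]$ and $y,z\in\{0,1\}^k$, asks whether $x_i\oplus y=x_j\oplus z$, where $x_1,\dots,x_k\in\{0,1\}^k$ are the inputs. An $\mathrm{MEQ}_{k,k}$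 decision tree is a binary tree whose inner nodes are labelled by such queries and whose leaves are labelled by output values. *Claim.* 1. For every graph $G$ on $[k]$ and all nodes $v\ne w$: $v,w$ are false twins if and only if $\nu_v=\nu_w$, and they are true twins if and only if $\nu_v\oplus e_v=\nu_w\oplus e_w$. 2. There is a constant $C>0$ such that for every $k\ge 0$ the following hold. (a) There is an $\mathrm{MEQ}_{k,k}$ decision tree of depth $2\binom{k}{2}$, each of whose queries is of the form $\mathrm{MEQ}_{k,k}(v,w,0^k,0^k)$ or $\mathrm{MEQ}_{k,k}(v,w,e_v,e_w)$ with $v\neq w$, that outputs the neighborhood diversity of $G$ on the inputs $\nu_1,\dots,\nu_k$, for every graph $G$ on $[k]$. (b) There is a bounded-error quantum protocol in the NIH network model that computes the neighborhood diversity of graphs on $[k]$ with communication cost at most $C\,k\log^2 k$ (for $k=0$ the bound is read as $0$). -/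

import Mathlib

namespace QNIH

/-! ### Bit strings and modified equality queries -/

/-- Bitwise exclusive or of two `n`-bit strings. -/
def bitXor {n : ℕ} (x y : Fin n → Bool) : Fin n → Bool := fun u => xor (x u) (y u)

/-- The string `0^n`. -/
def zeroStr (n : ℕ) : Fin n → Bool := fun _ => false

/-- The characteristic vector `e_v` of the singleton `{v}`. -/
def unitStr {n : ℕ} (v : Fin n) : Fin n → Bool := fun u => decide (u = v)

/-- A modified equality query: two player indices and two known strings. -/
structure MEQQuery (k n : ℕ) where
  i : Fin k
  j : Fin k
  y : Fin n → Bool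
  z : Fin n → Bool

/-- The query asks whether `x_i ⊕ y = x_j ⊕ z`. -/
def MEQQuery.Holds {k n : ℕ} (Q : MEQQuery k n) (x : Fin k → Fin n → Bool) : Prop :=
  bitXor (x Q.i) Q.y = bitXor (x Q.j) Q.z

instance {k n : ℕ} (Q : MEQQuery k n) (x : Fin k → Fin n → Bool) : Decidable (Q.Holds x) :=
  inferInstanceAs (Decidable (bitXor (x Q.i) Q.y = bitXor (x Q.j) Q.z))

/-- Decision trees over modified equality queries, with leaves labelled by elements of `S`.
In `node Q l r` the left child `l` is taken when the query fails, the right child `r` when it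
holds. -/
inductive MEQTree (k n : ℕ) (S : Type) : Type
  | leaf (s : S) : MEQTree k n S
  | node (Q : MEQQuery k n) (l r : MEQTree k n S) : MEQTree k n S

namespace MEQTree

variable {k n : ℕ} {S : Type}

/-- The label of the leaf that is reached on input `x`. -/
def eval : MEQTree k n S → (Fin k → Fin n → Bool) → S
  | leaf s, _ => s
  | node Q l r, x => if Q.Holds x then r.eval x else l.eval x

/-- The largest number of queries on a path from the root to a leaf. -/
def depth : MEQTree k n S → ℕ
  | leaf _ => 0
  | node _ l r => max l.depth r.depth + 1

/-- The set of the queries that label the inner nodes. -/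
def queries : MEQTree k n S → Set (MEQQuery k n)
  | leaf _ => ∅
  | node Q l r => {Q} ∪ (l.queries ∪ r.queries)

end MEQTree

/-! ### Quantum simultaneous message-passing protocols -/

/-- A pure state of a quantum register whose computational basis is indexed by `d`. -/
structure PureState (d : Type) [Fintype d] where
  amp : d → ℂ
  normalized : ∑ a, ‖amp a‖ ^ 2 = 1

/-- The product (unentangled) state of several registers. -/
def PureState.tensor {k : ℕ} {d : Fin k → Type} [∀ v, Fintype (d v)]
    (ψ : ∀ v, PureState (d v)) : PureState (∀ v, d v) where
  amp a := ∏ v, (ψ v).amp (a v)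
  normalized := by
    classical
    have h : ∑ a : (∀ v, d v), ‖∏ v, (ψ v).amp (a v)‖ ^ 2
        = ∏ v, ∑ b, ‖(ψ v).amp b‖ ^ 2 := by
      rw [Fintype.prod_sum]
      refine Finset.sum_congr rfl fun a _ => ?_
      rw [norm_prod, Finset.prod_pow]
    rw [h]
    exact Finset.prod_eq_one fun v _ => (ψ v).normalized

open scoped ComplexOrder in
/-- A general quantum measurement (positive operator-valued measure) with finitely many
outcomes. -/
structure Measurement (d Ω : Type) [Fintype d] [DecidableEq d] [Fintype Ω] where
  effect : Ω → Matrix d d ℂ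
  posSemidef : ∀ ω, (effect ω).PosSemidef
  sum_effect : ∑ ω, effect ω = 1

/-- The probability `⟨ψ|E_ω|ψ⟩` of the outcome `ω` in the state `ψ`. -/
def Measurement.prob {d Ω : Type} [Fintype d] [DecidableEq d] [Fintype Ω]
    (M : Measurement d Ω) (ψ : PureState d) (ω : Ω) : ℝ :=
  (star ψ.amp ⬝ᵥ (M.effect ω).mulVec ψ.amp).re

/-- A quantum simultaneous message-passing protocol with `k` players, inputs in `X` and outputs
in `S`. Player `v` sends a state of `qubits v` qubits that depends only on its own input; there
is neither shared randomness nor shared entanglement, so the referee holds the product of the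
messages. The referee measures it and computes the output from the outcome. -/
structure QuantumSMP (k : ℕ) (X S : Type) where
  qubits : Fin k → ℕ
  message : ∀ v, X → PureState (Fin (2 ^ qubits v))
  numOutcomes : ℕ
  measurement : Measurement (∀ v, Fin (2 ^ qubits v)) (Fin numOutcomes)
  output : Fin numOutcomes → S

namespace QuantumSMP

variable {k : ℕ} {X S : Type}

/-- The communication cost: the total number of qubits sent to the referee. -/
def cost (P : QuantumSMP k X S) : ℕ := ∑ v, P.qubits v

open scoped Classical in
/-- The probability that the referee outputs `s` when the inputs are `x`. -/
noncomputable def outputProb (P : QuantumSMP k X S) (x : Fin k → X) (s : S) : ℝ :=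
  ∑ ω, if P.output ω = s then
    P.measurement.prob (PureState.tensor fun v => P.message v (x v)) ω else 0

end QuantumSMP

/-! ### Graphs, twins and neighborhood diversity -/

open scoped Classical in
/-- The neighborhood vectors: `nu G v` is the characteristic vector of the set of neighbors
of `v`. In the number-in-hand network model it is the input of player `v`. -/
noncomputable def nu {k : ℕ} (G : SimpleGraph (Fin k)) (v : Fin k) : Fin k → Bool :=
  fun u => decide (G.Adj v u)

/-- A quantum protocol in the number-in-hand network model on `k` nodes. -/
abbrev NIHProtocol (k : ℕ) (S : Type) := QuantumSMP k (Fin k → Bool) S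

/-- `P` is a bounded-error protocol for the graph parameter `f`. -/
def NIHProtocol.ComputesBoundedError {k : ℕ} {S : Type} (P : NIHProtocol k S)
    (f : SimpleGraph (Fin k) → S) : Prop :=
  ∀ G : SimpleGraph (Fin k), 2 / 3 ≤ QuantumSMP.outputProb P (nu G) (f G)

/-- False twins: not adjacent, with the same neighborhood. -/
def FalseTwins {V : Type} (G : SimpleGraph V) (u v : V) : Prop :=
  ¬ G.Adj u v ∧ G.neighborSet u = G.neighborSet v

/-- True twins: adjacent, with the same closed neighborhood. -/
def TrueTwins {V : Type} (G : SimpleGraph V) (u v : V) : Prop :=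
  G.Adj u v ∧ G.neighborSet u ∪ {u} = G.neighborSet v ∪ {v}

/-- Twins: false twins or true twins. Every node is (trivially) a false twin of itself. -/
def Twins {V : Type} (G : SimpleGraph V) (u v : V) : Prop :=
  FalseTwins G u v ∨ TrueTwins G u v

/-- The nodes of `G` can be partitioned into `d` nonempty sets, each consisting of nodes that
are twins of one another. -/
def HasTwinPartition {V : Type} [Fintype V] [DecidableEq V] (G : SimpleGraph V) (d : ℕ) : Prop :=
  ∃ P : Finpartition (Finset.univ : Finset V),
    P.parts.card = d ∧ ∀ s ∈ P.parts, ∀ u ∈ s, ∀ v ∈ s, Twins G u v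

/-- The neighborhood diversity: the least size of a partition into sets of twins. -/
noncomputable def neighborhoodDiversity {V : Type} [Fintype V] [DecidableEq V]
    (G : SimpleGraph V) : ℕ :=
  sInf {d | HasTwinPartition G d}

/-- The infimum is over a nonempty set, and is therefore a minimum. -/
theorem neighborhoodDiversity_isLeast {V : Type} [Fintype V] [DecidableEq V]
    (G : SimpleGraph V) :
    IsLeast {d | HasTwinPartition G d} (neighborhoodDiversity G) := by
  have hne : {d | HasTwinPartition G d}.Nonempty := by
    refine ⟨_, (⊥ : Finpartition (Finset.univ : Finset V)), rfl, ?_⟩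
    intro s hs u hu v hv
    obtain ⟨a, _, rfl⟩ := Finpartition.mem_bot_iff.1 hs
    rw [Finset.mem_singleton] at hu hv
    subst hu hv
    exact Or.inl ⟨G.loopless.irrefl _, rfl⟩
  exact ⟨Nat.sInf_mem hne, fun d hd => Nat.sInf_le hd⟩

end QNIH

/-!
Two nodes are twins exactly when one of two modified equality queries on the neighborhood vectors
holds, and the twin relation determines the neighborhood diversity. Hence a tree that makes both
queries for every pair of nodes computes it.

Any such tree of depth `D` is turned into a quantum protocol. Every player sends `r` copies of the
fingerprint `∑ t, |t⟩|c(x)(t)⟩` of its input, where `c` is a Reed–Solomon code over a field of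
characteristic 2. As `c` is additive, the referee can mask a fingerprint: a permutation of the basis
turns the fingerprint of `x` into the one of `x ⊕ y`. Fingerprints of different strings have overlap
at most `1 / 2`, so the swap test for an equality query always accepts if the query holds, and
otherwise accepts all `r` copies with probability at most `((1 + 1 / 4) / 2) ^ r = (5 / 8) ^ r`.
Performed as a projective measurement, each test moves the state by at most `√((5 / 8) ^ r)`, so the
whole path to the correct leaf moves it by at most `D * √((5 / 8) ^ r)`. It is enough to take `r`
logarithmic in `D`, and a copy of a fingerprint takes `O(log k)` qubits.
-/

namespace QNIH

open scoped InnerProductSpace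

/-! ### Twins as modified equality queries -/

theorem FalseTwins.refl {V : Type} (G : SimpleGraph V) (v : V) : FalseTwins G v v :=
  ⟨G.irrefl, rfl⟩

theorem Twins.symm {V : Type} {G : SimpleGraph V} {v w : V} (h : Twins G v w) : Twins G w v :=
  h.imp (fun h => ⟨fun hwv => h.1 hwv.symm, h.2.symm⟩) fun h => ⟨h.1.symm, h.2.symm⟩

theorem twins_comm {V : Type} {G : SimpleGraph V} {v w : V} : Twins G v w ↔ Twins G w v :=
  ⟨Twins.symm, Twins.symm⟩

theorem falseTwins_iff_neighborSet_eq {V : Type} {G : SimpleGraph V} {v w : V} :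
    FalseTwins G v w ↔ G.neighborSet v = G.neighborSet w := by
  refine ⟨And.right, fun h => ⟨fun hvw => ?_, h⟩⟩
  have hww : w ∈ G.neighborSet w := h ▸ hvw
  exact G.irrefl hww

theorem trueTwins_iff_closedNeighborSet_eq {V : Type} {G : SimpleGraph V} {v w : V}
    (hvw : v ≠ w) :
    TrueTwins G v w ↔ G.neighborSet v ∪ {v} = G.neighborSet w ∪ {w} := by
  refine ⟨And.right, fun h => ⟨?_, h⟩⟩
  have hw : w ∈ G.neighborSet v ∪ {v} := h ▸ Or.inr rfl
  exact hw.resolve_right hvw.symm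

theorem neighborhoodDiversity_congr {V : Type} [Fintype V] [DecidableEq V] {G H : SimpleGraph V}
    (h : ∀ v w, Twins G v w ↔ Twins H v w) :
    neighborhoodDiversity G = neighborhoodDiversity H := by
  simp only [neighborhoodDiversity, HasTwinPartition, h]

section NeighborhoodVectors

variable {k : ℕ} (G : SimpleGraph (Fin k)) {v w : Fin k}

open scoped Classical in
theorem bitXor_nu_zeroStr (v : Fin k) :
    bitXor (nu G v) (zeroStr k) = fun u => decide (u ∈ G.neighborSet v) := by
  funext u
  simp [bitXor, nu, zeroStr]

open scoped Classical in
/- As `v` is not its own neighbor, adding `e_v` modulo 2 is inserting `v` into the set. -/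
theorem bitXor_nu_unitStr (v : Fin k) :
    bitXor (nu G v) (unitStr v) = fun u => decide (u ∈ G.neighborSet v ∪ {v}) := by
  funext u
  rcases eq_or_ne u v with rfl | huv
  · simp [bitXor, nu, unitStr]
  · simp [bitXor, nu, unitStr, huv]

theorem falseTwins_iff_holds :
    FalseTwins G v w ↔ MEQQuery.Holds ⟨v, w, zeroStr k, zeroStr k⟩ (nu G) := by
  rw [falseTwins_iff_neighborSet_eq, MEQQuery.Holds, bitXor_nu_zeroStr, bitXor_nu_zeroStr]
  simp only [funext_iff, decide_eq_decide, Set.ext_iff]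

theorem trueTwins_iff_holds (hvw : v ≠ w) :
    TrueTwins G v w ↔ MEQQuery.Holds ⟨v, w, unitStr v, unitStr w⟩ (nu G) := by
  rw [trueTwins_iff_closedNeighborSet_eq hvw, MEQQuery.Holds, bitXor_nu_unitStr,
    bitXor_nu_unitStr]
  simp only [funext_iff, decide_eq_decide, Set.ext_iff]

/-- The twin query of an ordered pair of nodes. Both kinds of twins have to be tested for every
unordered pair, so the order of the pair selects the kind: false twins if `v < w`, true twins
otherwise. -/
def twinQuery (v w : Fin k) : MEQQuery k k :=
  if v < w then ⟨v, w, zeroStr k, zeroStr k⟩ else ⟨v, w, unitStr v, unitStr w⟩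

theorem twins_iff_twinQuery_holds (hvw : v ≠ w) :
    Twins G v w ↔ (twinQuery v w).Holds (nu G) ∨ (twinQuery w v).Holds (nu G) := by
  wlog hlt : v < w generalizing v w
  · rw [twins_comm, or_comm]
    exact this hvw.symm (hvw.lt_or_gt.resolve_left hlt)
  have htrue : TrueTwins G v w ↔ TrueTwins G w v := by
    rw [TrueTwins, TrueTwins, G.adj_comm, eq_comm]
  rw [twinQuery, twinQuery, if_pos hlt, if_neg hlt.not_gt, ← falseTwins_iff_holds,
    ← trueTwins_iff_holds G hvw.symm, ← htrue, Twins]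

end NeighborhoodVectors

/-! ### Decision trees from lists of queries -/

/- The queries of the list are made one after the other; `A` is the set of instances that are
consistent with the answers so far. -/
theorem MEQTree.exists_forall_eval_eq {k n : ℕ} {S : Type} [Nonempty S] {X : Type*}
    (x : X → Fin k → Fin n → Bool) (f : X → S) (qs : List (MEQQuery k n)) (A : Set X)
    (hf : ∀ a ∈ A, ∀ b ∈ A, (∀ Q ∈ qs, Q.Holds (x a) ↔ Q.Holds (x b)) → f a = f b) :
    ∃ T : MEQTree k n S, T.depth = qs.length ∧ (∀ Q ∈ T.queries, Q ∈ qs) ∧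
      ∀ a ∈ A, T.eval (x a) = f a := by
  induction qs generalizing A with
  | nil =>
    obtain ⟨s, hs⟩ : ∃ s, ∀ a ∈ A, s = f a := by
      rcases A.eq_empty_or_nonempty with rfl | ⟨a, ha⟩
      · exact ⟨Classical.arbitrary S, by simp⟩
      · exact ⟨f a, fun b hb => hf a ha b hb (by simp)⟩
    exact ⟨leaf s, rfl, by simp [queries], hs⟩
  | cons Q qs ih =>
    obtain ⟨l, hl_depth, hl_queries, hl_eval⟩ := ih {a ∈ A | ¬ Q.Holds (x a)}
      fun a ha b hb hab => hf a ha.1 b hb.1 (List.forall_mem_cons.2 ⟨iff_of_false ha.2 hb.2, hab⟩)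
    obtain ⟨r, hr_depth, hr_queries, hr_eval⟩ := ih {a ∈ A | Q.Holds (x a)}
      fun a ha b hb hab => hf a ha.1 b hb.1 (List.forall_mem_cons.2 ⟨iff_of_true ha.2 hb.2, hab⟩)
    refine ⟨node Q l r, by simp [depth, hl_depth, hr_depth], ?_, fun a ha => ?_⟩
    · rintro R (rfl | hR | hR)
      · exact List.mem_cons_self
      · exact List.mem_cons_of_mem _ (hl_queries R hR)
      · exact List.mem_cons_of_mem _ (hr_queries R hR)
    · rw [eval]
      split_ifs with hQ
      · exact hr_eval a ⟨ha, hQ⟩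
      · exact hl_eval a ⟨ha, hQ⟩

theorem two_mul_choose_two (k : ℕ) : 2 * k.choose 2 = k * (k - 1) := by
  rw [Nat.choose_two_right, Nat.mul_div_cancel' (Nat.even_mul_pred_self k).two_dvd]

theorem exists_tree_neighborhoodDiversity (k : ℕ) : ∃ T : MEQTree k k ℕ,
    T.depth = 2 * k.choose 2 ∧
    (∀ Q ∈ T.queries, Q.i ≠ Q.j ∧ ((Q.y = zeroStr k ∧ Q.z = zeroStr k) ∨
      (Q.y = unitStr Q.i ∧ Q.z = unitStr Q.j))) ∧
    ∀ G : SimpleGraph (Fin k), T.eval (nu G) = neighborhoodDiversity G := by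
  let qs : List (MEQQuery k k) := Finset.univ.offDiag.toList.map fun p => twinQuery p.1 p.2
  have hqs : ∀ Q, Q ∈ qs ↔ ∃ v w, v ≠ w ∧ twinQuery v w = Q := by simp [qs]
  have hlength : qs.length = 2 * k.choose 2 := by
    rw [List.length_map, Finset.length_toList, Finset.offDiag_card, Finset.card_univ,
      Fintype.card_fin, ← Nat.mul_sub_one, two_mul_choose_two]
  have hdetermined : ∀ G ∈ Set.univ, ∀ H ∈ Set.univ,
      (∀ Q ∈ qs, Q.Holds (nu G) ↔ Q.Holds (nu H)) →
        neighborhoodDiversity G = neighborhoodDiversity H := by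
    intro G _ H _ h
    refine neighborhoodDiversity_congr fun v w => ?_
    rcases eq_or_ne v w with rfl | hvw
    · exact iff_of_true (Or.inl (.refl G v)) (Or.inl (.refl H v))
    · rw [twins_iff_twinQuery_holds G hvw, twins_iff_twinQuery_holds H hvw,
        h _ ((hqs _).2 ⟨v, w, hvw, rfl⟩), h _ ((hqs _).2 ⟨w, v, hvw.symm, rfl⟩)]
  obtain ⟨T, hdepth, hqueries, heval⟩ :=
    MEQTree.exists_forall_eval_eq nu neighborhoodDiversity qs Set.univ hdetermined
  refine ⟨T, hdepth.trans hlength, fun Q hQ => ?_, fun G => heval G trivial⟩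
  obtain ⟨v, w, hvw, rfl⟩ := (hqs Q).1 (hqueries Q hQ)
  unfold twinQuery
  split_ifs
  · exact ⟨hvw, Or.inl ⟨rfl, rfl⟩⟩
  · exact ⟨hvw, Or.inr ⟨rfl, rfl⟩⟩


/-! ### Gentle sequential measurements -/

theorem norm_apply_le_of_sum_star_mul_self_eq_one {𝕜 E Ω : Type*} [RCLike 𝕜]
    [NormedAddCommGroup E] [InnerProductSpace 𝕜 E] [CompleteSpace E] [Fintype Ω]
    {K : Ω → E →L[𝕜] E} (hK : ∑ ω, star (K ω) * K ω = 1) (ω : Ω) (ψ : E) :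
    ‖K ω ψ‖ ≤ ‖ψ‖ := by
  have hsum : ∑ ω, ‖K ω ψ‖ ^ 2 = ‖ψ‖ ^ 2 := by
    simp only [← @inner_self_eq_norm_sq 𝕜, ← ContinuousLinearMap.adjoint_inner_right,
      ← ContinuousLinearMap.star_eq_adjoint, ← map_sum, ← inner_sum]
    simp only [← mul_apply_eq_comp, ← sum_apply, hK, one_apply_eq_self]
  refine le_of_sq_le_sq ?_ (norm_nonneg ψ)
  rw [← hsum]
  exact Finset.single_le_sum (f := fun ω => ‖K ω ψ‖ ^ 2) (fun _ _ => sq_nonneg _)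
    (Finset.mem_univ ω)

theorem norm_mul_apply_sub_le {𝕜 E : Type*} [NontriviallyNormedField 𝕜] [NormedAddCommGroup E]
    [NormedSpace 𝕜 E] {K p : E →L[𝕜] E} {ψ : E} {δ ε : ℝ} (hK : ∀ φ, ‖K φ‖ ≤ ‖φ‖)
    (hp : ‖p ψ - ψ‖ ≤ δ) (hKψ : ‖K ψ - ψ‖ ≤ ε) : ‖(K * p) ψ - ψ‖ ≤ δ + ε :=
  calc ‖(K * p) ψ - ψ‖ = ‖K (p ψ - ψ) + (K ψ - ψ)‖ := by
        rw [mul_apply_eq_comp, map_sub, sub_add_sub_cancel]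
    _ ≤ δ + ε := norm_add_le_of_le ((hK _).trans hp) hKψ

namespace MEQTree

variable {k n : ℕ} {S : Type}

/-- The leaves of a decision tree: the possible outcomes of a run. -/
def Leaf : MEQTree k n S → Type
  | leaf _ => Unit
  | node _ l r => l.Leaf ⊕ r.Leaf

instance Leaf.instFintype : ∀ T : MEQTree k n S, Fintype T.Leaf
  | leaf _ => inferInstanceAs (Fintype Unit)
  | node _ l r =>
    have := instFintype l
    have := instFintype r
    inferInstanceAs (Fintype (l.Leaf ⊕ r.Leaf))

/-- The output value at a leaf. -/
def label : ∀ T : MEQTree k n S, T.Leaf → S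
  | leaf s, _ => s
  | node _ l _, Sum.inl ω => l.label ω
  | node _ _ r, Sum.inr ω => r.label ω

/-- The leaf that is reached on input `x`. -/
def leafAt (x : Fin k → Fin n → Bool) : ∀ T : MEQTree k n S, T.Leaf
  | leaf _ => ()
  | node Q l r => if Q.Holds x then Sum.inr (r.leafAt x) else Sum.inl (l.leafAt x)

theorem leafAt_node_of_holds {x : Fin k → Fin n → Bool} {Q : MEQQuery k n} {l r : MEQTree k n S}
    (hQ : Q.Holds x) : (node Q l r).leafAt x = Sum.inr (r.leafAt x) :=
  if_pos hQ

theorem leafAt_node_of_not_holds {x : Fin k → Fin n → Bool} {Q : MEQQuery k n}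
    {l r : MEQTree k n S} (hQ : ¬ Q.Holds x) : (node Q l r).leafAt x = Sum.inl (l.leafAt x) :=
  if_neg hQ

theorem label_leafAt (x : Fin k → Fin n → Bool) (T : MEQTree k n S) :
    T.label (T.leafAt x) = T.eval x := by
  induction T with
  | leaf s => rfl
  | node Q l r hl hr =>
    by_cases hQ : Q.Holds x
    · rw [leafAt_node_of_holds hQ, eval, if_pos hQ]
      exact hr
    · rw [leafAt_node_of_not_holds hQ, eval, if_neg hQ]
      exact hl

/-- The Kraus operator of a leaf when the tree is run with the query `Q` replaced by the
projective measurement `{P Q, 1 - P Q}`: the product of the projections along the path from the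
root, the one at the root acting first. -/
def kraus {A : Type*} [Ring A] (P : MEQQuery k n → A) : ∀ T : MEQTree k n S, T.Leaf → A
  | leaf _, _ => 1
  | node Q l _, Sum.inl ω => l.kraus P ω * (1 - P Q)
  | node Q _ r, Sum.inr ω => r.kraus P ω * P Q

theorem map_kraus {A B : Type*} [Ring A] [Ring B] {F : Type*} [FunLike F A B]
    [RingHomClass F A B] (φ : F) (P : MEQQuery k n → A)
    (T : MEQTree k n S) (ω : T.Leaf) : φ (T.kraus P ω) = T.kraus (fun Q => φ (P Q)) ω := by
  induction T with
  | leaf s => exact map_one φ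
  | node Q l r hl hr => rcases ω with ω | ω <;> simp [kraus, hl, hr]

theorem sum_star_kraus_mul_kraus {A : Type*} [Ring A] [StarRing A] {P : MEQQuery k n → A}
    (hP : ∀ Q, IsStarProjection (P Q)) (T : MEQTree k n S) :
    ∑ ω, star (T.kraus P ω) * T.kraus P ω = 1 := by
  induction T with
  | leaf s => exact (Fintype.sum_unique (ι := Unit) _).trans (by simp [kraus])
  | node Q l r hl hr =>
    have hbranch : ∀ {Ω : Type} [Fintype Ω] {K : Ω → A} {p : A}, IsStarProjection p →
        ∑ ω, star (K ω) * K ω = 1 → ∑ ω, star (K ω * p) * (K ω * p) = p := by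
      intro Ω _ K p hp hK
      calc ∑ ω, star (K ω * p) * (K ω * p) = star p * (∑ ω, star (K ω) * K ω) * p := by
            simp only [star_mul, Finset.mul_sum, Finset.sum_mul, mul_assoc]
        _ = p := by rw [hK, mul_one, hp.isSelfAdjoint.star_eq, hp.isIdempotentElem.eq]
    calc ∑ ω, star ((node Q l r).kraus P ω) * (node Q l r).kraus P ω
        = ∑ ω, star (l.kraus P ω * (1 - P Q)) * (l.kraus P ω * (1 - P Q))
          + ∑ ω, star (r.kraus P ω * P Q) * (r.kraus P ω * P Q) := Fintype.sum_sum_type _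
      _ = 1 - P Q + P Q := by rw [hbranch (hP Q).one_sub hl, hbranch (hP Q) hr]
      _ = 1 := sub_add_cancel 1 (P Q)

/- A projection that almost certainly gives the predicted answer hardly moves the state, and the
later Kraus operators are contractions, so the displacements add up along the path. -/
theorem norm_kraus_leafAt_sub_le {𝕜 E : Type*} [RCLike 𝕜] [NormedAddCommGroup E]
    [InnerProductSpace 𝕜 E] [CompleteSpace E] {P : MEQQuery k n → E →L[𝕜] E}
    (hP : ∀ Q, IsStarProjection (P Q)) {x : Fin k → Fin n → Bool} {ψ : E} {δ : ℝ}
    (hδ : ∀ Q, ‖P Q ψ - if Q.Holds x then ψ else 0‖ ≤ δ) (T : MEQTree k n S) :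
    ‖T.kraus P (T.leafAt x) ψ - ψ‖ ≤ T.depth * δ := by
  induction T with
  | leaf s => simp [kraus, depth]
  | node Q l r hl hr =>
    have hδ_nonneg : 0 ≤ δ := (norm_nonneg _).trans (hδ Q)
    have hdepth : ∀ m ≤ max l.depth r.depth, δ + m * δ ≤ (node Q l r).depth * δ := by
      intro m hm
      rw [← one_add_mul]
      refine mul_le_mul_of_nonneg_right ?_ hδ_nonneg
      exact_mod_cast (add_comm 1 m).trans_le (Nat.add_le_add_right hm 1)
    have hcontraction (T : MEQTree k n S) :=
      norm_apply_le_of_sum_star_mul_self_eq_one (sum_star_kraus_mul_kraus hP T) (T.leafAt x)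
    by_cases hQ : Q.Holds x
    · have hp : ‖P Q ψ - ψ‖ ≤ δ := by simpa only [if_pos hQ] using hδ Q
      rw [leafAt_node_of_holds hQ]
      exact (norm_mul_apply_sub_le (hcontraction r) hp hr).trans (hdepth _ (le_max_right _ _))
    · have hp : ‖(1 - P Q) ψ - ψ‖ ≤ δ := by simpa [if_neg hQ] using hδ Q
      rw [leafAt_node_of_not_holds hQ]
      exact (norm_mul_apply_sub_le (hcontraction l) hp hl).trans (hdepth _ (le_max_left _ _))

end MEQTree

/-! ### States and measurements -/

section States

variable {d d' : Type} [Fintype d] [Fintype d']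

/-- The amplitude vector of a state as an element of the Hilbert space of the register. -/
noncomputable def PureState.vec (ψ : PureState d) : EuclideanSpace ℂ d :=
  WithLp.toLp 2 ψ.amp

theorem PureState.norm_vec (ψ : PureState d) : ‖ψ.vec‖ = 1 := by
  rw [EuclideanSpace.norm_eq, Real.sqrt_eq_one]
  exact ψ.normalized

theorem PureState.inner_vec (φ ψ : PureState d) :
    ⟪φ.vec, ψ.vec⟫_ℂ = ∑ a, ψ.amp a * star (φ.amp a) := by
  simp only [vec, EuclideanSpace.inner_eq_star_dotProduct, dotProduct, Pi.star_apply]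

theorem PureState.inner_vec_self (ψ : PureState d) : ⟪ψ.vec, ψ.vec⟫_ℂ = 1 := by
  simp [inner_self_eq_norm_sq_to_K, norm_vec]

/-- The state obtained by relabelling the computational basis: the basis vector `a` of the new
register is the basis vector `e a` of the old one. -/
def PureState.reindex (e : d ≃ d') (ψ : PureState d') : PureState d where
  amp a := ψ.amp (e a)
  normalized := (e.sum_comp fun a => ‖ψ.amp a‖ ^ 2).trans ψ.normalized

theorem PureState.inner_vec_reindex (e : d ≃ d') (φ ψ : PureState d') :
    ⟪(φ.reindex e).vec, (ψ.reindex e).vec⟫_ℂ = ⟪φ.vec, ψ.vec⟫_ℂ := by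
  rw [inner_vec, inner_vec]
  exact e.sum_comp fun a => ψ.amp a * star (φ.amp a)

theorem PureState.inner_vec_tensor {k : ℕ} {d : Fin k → Type} [∀ v, Fintype (d v)]
    (φ ψ : ∀ v, PureState (d v)) :
    ⟪(tensor φ).vec, (tensor ψ).vec⟫_ℂ = ∏ v, ⟪(φ v).vec, (ψ v).vec⟫_ℂ := by
  simp only [inner_vec, Fintype.prod_sum]
  simp only [tensor, star_prod, Finset.prod_mul_distrib]

variable [DecidableEq d] [DecidableEq d'] {Ω Ω' : Type} [Fintype Ω] [Fintype Ω']

theorem PureState.toEuclideanCLM_vec (A : Matrix d d ℂ) (ψ : PureState d) :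
    Matrix.toEuclideanCLM (𝕜 := ℂ) A ψ.vec = WithLp.toLp 2 (A.mulVec ψ.amp) :=
  Matrix.toEuclideanCLM_toLp A ψ.amp

open scoped ComplexOrder in
/-- The measurement with a given family of Kraus operators. -/
def Measurement.ofKraus (K : Ω → Matrix d d ℂ) (hK : ∑ ω, star (K ω) * K ω = 1) :
    Measurement d Ω where
  effect ω := star (K ω) * K ω
  posSemidef ω := Matrix.posSemidef_conjTranspose_mul_self (K ω)
  sum_effect := hK

theorem Measurement.prob_ofKraus (K : Ω → Matrix d d ℂ) (hK : ∑ ω, star (K ω) * K ω = 1)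
    (ψ : PureState d) (ω : Ω) :
    (ofKraus K hK).prob ψ ω = ‖Matrix.toEuclideanCLM (𝕜 := ℂ) (K ω) ψ.vec‖ ^ 2 := by
  change (star ψ.amp ⬝ᵥ (star (K ω) * K ω).mulVec ψ.amp).re = _
  rw [Matrix.star_eq_conjTranspose, ← Matrix.mulVec_mulVec,
    Matrix.dotProduct_mulVec, Matrix.vecMul_conjTranspose, star_star, ψ.toEuclideanCLM_vec,
    @norm_sq_eq_re_inner ℂ, EuclideanSpace.inner_eq_star_dotProduct, dotProduct_comm]
  rfl

open scoped ComplexOrder in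
/-- The same measurement after relabelling the computational basis and the outcomes. -/
def Measurement.reindex (e : d ≃ d') (o : Ω ≃ Ω') (M : Measurement d' Ω') : Measurement d Ω where
  effect ω := (M.effect (o ω)).submatrix e e
  posSemidef ω := (M.posSemidef (o ω)).submatrix e
  sum_effect := by
    rw [o.sum_comp fun ω => (M.effect ω).submatrix e e]
    ext a b
    simpa [Matrix.sum_apply, Matrix.one_apply] using congrFun₂ M.sum_effect (e a) (e b)

theorem Measurement.prob_reindex (e : d ≃ d') (o : Ω ≃ Ω') (M : Measurement d' Ω')
    (ψ : PureState d') (ω : Ω) : (M.reindex e o).prob (ψ.reindex e) ω = M.prob ψ (o ω) := by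
  have h := Matrix.submatrix_mulVec_equiv (M.effect (o ω)) (ψ.amp ∘ e) e e
  rw [Function.comp_assoc, e.self_comp_symm, Function.comp_id] at h
  change (star (ψ.amp ∘ e) ⬝ᵥ ((M.effect (o ω)).submatrix e e).mulVec (ψ.amp ∘ e)).re = _
  rw [h, prob]
  congr 1
  exact comp_equiv_dotProduct_comp_equiv (star ψ.amp) _ e

theorem Measurement.prob_nonneg (M : Measurement d Ω) (ψ : PureState d) (ω : Ω) :
    0 ≤ M.prob ψ ω :=
  (M.posSemidef ω).re_dotProduct_nonneg ψ.amp

theorem QuantumSMP.prob_le_outputProb {k : ℕ} {X S : Type} (P : QuantumSMP k X S) (x : Fin k → X)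
    (ω : Fin P.numOutcomes) :
    P.measurement.prob (PureState.tensor fun v => P.message v (x v)) ω ≤
      P.outputProb x (P.output ω) := by
  classical
  rw [outputProb, ← Finset.sum_filter]
  exact Finset.single_le_sum (f := P.measurement.prob _)
    (fun _ _ => P.measurement.prob_nonneg _ _) (by simp)

end States

/-- The sequential measurement that runs a decision tree, with the query `Q` answered by the
projective measurement `{P Q, 1 - P Q}`. -/
noncomputable def MEQTree.measurement {d : Type} [Fintype d] [DecidableEq d] {k n : ℕ} {S : Type}
    (T : MEQTree k n S) {P : MEQQuery k n → Matrix d d ℂ} (hP : ∀ Q, IsStarProjection (P Q)) :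
    Measurement d T.Leaf :=
  .ofKraus (T.kraus P) (T.sum_star_kraus_mul_kraus hP)

theorem MEQTree.le_prob_measurement_leafAt {d : Type} [Fintype d] [DecidableEq d] {k n : ℕ}
    {S : Type} (T : MEQTree k n S) {P : MEQQuery k n → Matrix d d ℂ}
    (hP : ∀ Q, IsStarProjection (P Q)) {x : Fin k → Fin n → Bool} {ψ : PureState d} {δ : ℝ}
    (hδ : ∀ Q, ‖Matrix.toEuclideanCLM (𝕜 := ℂ) (P Q) ψ.vec - if Q.Holds x then ψ.vec else 0‖ ≤ δ)
    (hdepth : T.depth * δ ≤ 1) :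
    (1 - T.depth * δ) ^ 2 ≤ (T.measurement hP).prob ψ (T.leafAt x) := by
  let Φ := Matrix.toEuclideanCLM (n := d) (𝕜 := ℂ)
  have hdisplacement : ‖Φ (T.kraus P (T.leafAt x)) ψ.vec - ψ.vec‖ ≤ T.depth * δ := by
    rw [T.map_kraus Φ]
    exact norm_kraus_leafAt_sub_le (fun Q => (hP Q).map Φ) hδ T
  have htriangle := norm_sub_norm_le ψ.vec (Φ (T.kraus P (T.leafAt x)) ψ.vec)
  rw [norm_sub_rev, ψ.norm_vec] at htriangle
  rw [measurement, Measurement.prob_ofKraus]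
  exact pow_le_pow_left₀ (by linarith) (by linarith) 2


/-! ### Tensor products of operators -/

section TensorMatrix

variable {ι : Type*} [Fintype ι] {R : Type*} [CommSemiring R]

/-- The tensor (Kronecker) product of a finite family of square matrices, indexed by the product of
the index types as in `PureState.tensor`. -/
def tensorMatrix {m : ι → Type*} (A : ∀ i, Matrix (m i) (m i) R) :
    Matrix (∀ i, m i) (∀ i, m i) R :=
  .of fun a b => ∏ i, A i (a i) (b i)

theorem star_tensorMatrix {m : ι → Type*} [StarRing R] (A : ∀ i, Matrix (m i) (m i) R) :
    star (tensorMatrix A) = tensorMatrix fun i => star (A i) := by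
  ext a b
  simp only [tensorMatrix, Matrix.star_apply, Matrix.of_apply, star_prod]

variable [DecidableEq ι] {m : ι → Type*} [∀ i, Fintype (m i)]

theorem tensorMatrix_mul_tensorMatrix (A B : ∀ i, Matrix (m i) (m i) R) :
    tensorMatrix A * tensorMatrix B = tensorMatrix fun i => A i * B i := by
  ext a b
  simp only [tensorMatrix, Matrix.mul_apply, Matrix.of_apply, Fintype.prod_sum,
    Finset.prod_mul_distrib]

theorem isStarProjection_tensorMatrix [StarRing R] {A : ∀ i, Matrix (m i) (m i) R}
    (hA : ∀ i, IsStarProjection (A i)) : IsStarProjection (tensorMatrix A) where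
  isIdempotentElem := by
    rw [IsIdempotentElem, tensorMatrix_mul_tensorMatrix]
    exact congrArg tensorMatrix (funext fun i => (hA i).isIdempotentElem.eq)
  isSelfAdjoint := by
    rw [isSelfAdjoint_iff, star_tensorMatrix]
    exact congrArg tensorMatrix (funext fun i => (hA i).isSelfAdjoint.star_eq)

theorem tensorMatrix_mulVec_prod (A : ∀ i, Matrix (m i) (m i) R) (v : ∀ i, m i → R) :
    (tensorMatrix A).mulVec (fun a => ∏ i, v i (a i)) =
      fun a => ∏ i, (A i).mulVec (v i) (a i) := by
  funext a
  simp only [tensorMatrix, Matrix.mulVec, dotProduct, Matrix.of_apply, Fintype.prod_sum,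
    Finset.prod_mul_distrib]

end TensorMatrix

theorem norm_sq_toLp_prod {ι 𝕜 : Type*} [Fintype ι] [DecidableEq ι] [RCLike 𝕜]
    {m : ι → Type*} [∀ i, Fintype (m i)] (v : ∀ i, m i → 𝕜) :
    ‖WithLp.toLp 2 fun a : (∀ i, m i) => ∏ i, v i (a i)‖ ^ 2 =
      ∏ i, ‖WithLp.toLp 2 (v i)‖ ^ 2 := by
  simp only [EuclideanSpace.norm_sq_eq, norm_prod, ← Finset.prod_pow, Fintype.prod_sum]

theorem norm_sq_tensorMatrix_vec_tensor {r : ℕ} {d : Fin r → Type} [∀ i, Fintype (d i)]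
    [∀ i, DecidableEq (d i)] (A : ∀ i, Matrix (d i) (d i) ℂ) (ψ : ∀ i, PureState (d i)) :
    ‖Matrix.toEuclideanCLM (𝕜 := ℂ) (tensorMatrix A) (PureState.tensor ψ).vec‖ ^ 2 =
      ∏ i, ‖Matrix.toEuclideanCLM (𝕜 := ℂ) (A i) (ψ i).vec‖ ^ 2 := by
  simp only [PureState.toEuclideanCLM_vec]
  rw [← norm_sq_toLp_prod, PureState.tensor, tensorMatrix_mulVec_prod]

/-! ### The swap test -/

theorem apply_eq_self_of_norm_apply_eq {𝕜 E : Type*} [RCLike 𝕜] [NormedAddCommGroup E]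
    [InnerProductSpace 𝕜 E] [CompleteSpace E] {p : E →L[𝕜] E} (hp : IsStarProjection p) {ψ : E}
    (hψ : ‖p ψ‖ = ‖ψ‖) : p ψ = ψ := by
  have hadjoint : ContinuousLinearMap.adjoint p = p := hp.isSelfAdjoint.star_eq
  have hinner : ⟪p ψ, ψ⟫_𝕜 = ⟪p ψ, p ψ⟫_𝕜 :=
    calc ⟪p ψ, ψ⟫_𝕜 = ⟪p (p ψ), ψ⟫_𝕜 := by rw [← mul_apply_eq_comp, hp.isIdempotentElem.eq]
      _ = ⟪p ψ, p ψ⟫_𝕜 := by rw [← ContinuousLinearMap.adjoint_inner_right, hadjoint]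
  rw [← sub_eq_zero, ← norm_eq_zero, ← sq_eq_zero_iff, @norm_sub_sq 𝕜, hinner,
    inner_self_eq_norm_sq, hψ]
  ring

section SwapTest

variable {d : Type} [Fintype d]

/-- The projection of the swap test onto the states that are invariant under the permutation `π`
of the computational basis, for an involution `π`. -/
noncomputable def swapTest [DecidableEq d] (π : Equiv.Perm d) : Matrix d d ℂ :=
  (2⁻¹ : ℂ) • (1 + π.permMatrix ℂ)

theorem isStarProjection_swapTest [DecidableEq d] {π : Equiv.Perm d} (hπ : π * π = 1) :
    IsStarProjection (swapTest π) where
  isIdempotentElem := by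
    have hinvolution : π.permMatrix ℂ * π.permMatrix ℂ = 1 := by
      rw [← Matrix.permMatrix_mul, hπ, Matrix.permMatrix_one]
    rw [IsIdempotentElem, swapTest, smul_mul_smul_comm, add_mul, mul_add, mul_add, hinvolution,
      one_mul, one_mul, mul_one, add_comm (π.permMatrix ℂ) 1, ← two_smul ℂ, smul_smul]
    norm_num
  isSelfAdjoint := by
    rw [isSelfAdjoint_iff, swapTest, star_smul, star_add, star_one,
      Matrix.star_eq_conjTranspose (π.permMatrix ℂ), Matrix.conjTranspose_permMatrix,
      inv_eq_of_mul_eq_one_right hπ]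
    simp

theorem norm_sq_swapTest_vec [DecidableEq d] (π : Equiv.Perm d) (ψ : PureState d) :
    ‖Matrix.toEuclideanCLM (𝕜 := ℂ) (swapTest π) ψ.vec‖ ^ 2 =
      (1 + (⟪ψ.vec, (ψ.reindex π).vec⟫_ℂ).re) / 2 := by
  have hsymmetrize : Matrix.toEuclideanCLM (𝕜 := ℂ) (swapTest π) ψ.vec =
      (2⁻¹ : ℂ) • (ψ.vec + (ψ.reindex π).vec) := by
    rw [ψ.toEuclideanCLM_vec, swapTest, Matrix.smul_mulVec, Matrix.add_mulVec, Matrix.one_mulVec,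
      Matrix.permMatrix_mulVec]
    rfl
  rw [hsymmetrize, norm_smul, mul_pow, @norm_add_sq ℂ, ψ.norm_vec, (ψ.reindex π).norm_vec]
  simp only [norm_inv, Complex.norm_ofNat, RCLike.re_to_complex]
  ring

theorem norm_sq_tensorMatrix_swapTest [DecidableEq d] (π : Equiv.Perm d) (ψ : PureState d)
    (r : ℕ) :
    ‖Matrix.toEuclideanCLM (𝕜 := ℂ) (tensorMatrix fun _ : Fin r => swapTest π)
        (PureState.tensor fun _ => ψ).vec‖ ^ 2 =
      ((1 + (⟪ψ.vec, (ψ.reindex π).vec⟫_ℂ).re) / 2) ^ r := by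
  rw [norm_sq_tensorMatrix_vec_tensor, norm_sq_swapTest_vec, Finset.prod_const, Finset.card_univ,
    Fintype.card_fin]

theorem PureState.inner_vec_reindex_conj (V σ : Equiv.Perm d) (ψ : PureState d) :
    ⟪ψ.vec, (ψ.reindex (V * σ * V⁻¹)).vec⟫_ℂ =
      ⟪(ψ.reindex V).vec, ((ψ.reindex V).reindex σ).vec⟫_ℂ := by
  rw [← inner_vec_reindex V]
  simp only [inner_vec, reindex, Equiv.Perm.mul_apply, Equiv.Perm.coe_inv, Equiv.symm_apply_apply]

/-- The permutation of the computational basis of `k` equal registers that exchanges the contents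
of the registers `i` and `j`. -/
def slotSwap {k : ℕ} (d : Type) (i j : Fin k) : Equiv.Perm (Fin k → d) :=
  (Equiv.swap i j).arrowCongr (Equiv.refl d)

theorem slotSwap_mul_self {k : ℕ} (d : Type) (i j : Fin k) :
    slotSwap d i j * slotSwap d i j = 1 := by
  ext a v
  simp [slotSwap]

theorem PureState.inner_vec_reindex_slotSwap {k : ℕ} (φ : Fin k → PureState d) {i j : Fin k}
    (hij : i ≠ j) :
    ⟪(tensor φ).vec, ((tensor φ).reindex (slotSwap d i j)).vec⟫_ℂ =
      ‖⟪(φ i).vec, (φ j).vec⟫_ℂ‖ ^ 2 := by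
  have hswap : ((tensor φ).reindex (slotSwap d i j)).vec =
      (tensor fun v => φ (Equiv.swap i j v)).vec := by
    ext a
    change ∏ v, (φ v).amp (a (Equiv.swap i j v)) = ∏ v, (φ (Equiv.swap i j v)).amp (a v)
    rw [← Equiv.prod_comp (Equiv.swap i j)]
    simp only [Equiv.swap_apply_self]
  have hfixed : ∀ v, v ≠ i ∧ v ≠ j →
      ⟪(φ v).vec, (φ (Equiv.swap i j v)).vec⟫_ℂ = 1 := by
    rintro v ⟨hvi, hvj⟩
    rw [Equiv.swap_apply_of_ne_of_ne hvi hvj, inner_vec_self]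
  rw [hswap, inner_vec_tensor, Fintype.prod_eq_mul i j hij hfixed, Equiv.swap_apply_left,
    Equiv.swap_apply_right, ← inner_conj_symm (φ j).vec, RCLike.mul_conj]
  rfl

end SwapTest

/-! ### Fingerprints -/

section GraphState

variable {α β : Type} [Fintype α] [Nonempty α] [Fintype β] [DecidableEq β]

/-- The uniform superposition of the points of the graph of `f`. -/
noncomputable def graphState (f : α → β) : PureState (α × β) where
  amp p := if f p.1 = p.2 then ((√(Fintype.card α))⁻¹ : ℝ) else 0
  normalized := by
    simp [Fintype.sum_prod_type, apply_ite norm]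

theorem inner_vec_graphState (f g : α → β) :
    ⟪(graphState f).vec, (graphState g).vec⟫_ℂ =
      (Finset.card {t | f t = g t} : ℂ) / Fintype.card α := by
  rw [PureState.inner_vec, Fintype.sum_prod_type]
  have hpoint : ∀ t, ∑ b, (graphState g).amp (t, b) * star ((graphState f).amp (t, b)) =
      if f t = g t then (Fintype.card α : ℂ)⁻¹ else 0 := by
    intro t
    have hsqrt : (√(Fintype.card α : ℝ) : ℂ) * √(Fintype.card α : ℝ) = Fintype.card α := by
      exact_mod_cast Real.mul_self_sqrt (Nat.cast_nonneg (α := ℝ) (Fintype.card α))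
    rcases eq_or_ne (f t) (g t) with hfg | hfg
    · simp [graphState, hfg, ← mul_inv, hsqrt]
    · simp [graphState, hfg]
  simp only [hpoint]
  rw [← Finset.sum_filter, Finset.sum_const, nsmul_eq_mul, div_eq_mul_inv]

/-- The permutation that subtracts the function value from the second coordinate. -/
def graphShift [AddGroup β] (g : α → β) : Equiv.Perm (α × β) :=
  Equiv.prodShear (Equiv.refl α) fun t => Equiv.subRight (g t)

theorem graphState_reindex_graphShift [AddGroup β] (f g : α → β) :
    (graphState f).reindex (graphShift g) = graphState (f + g) := by
  simp [PureState.reindex, graphState, graphShift, eq_sub_iff_add_eq]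

end GraphState

/-- A code for quantum fingerprints: an additive family of functions on bit strings, any two of
which agree on at most half of the points. -/
structure FingerprintCode (n : ℕ) (α β : Type) [Fintype α] [DecidableEq β] [Add β] where
  toFun : (Fin n → Bool) → α → β
  map_bitXor : ∀ x y, toFun (bitXor x y) = toFun x + toFun y
  two_mul_card_agree_le : ∀ x y, x ≠ y →
    2 * Finset.card {t | toFun x t = toFun y t} ≤ Fintype.card α

namespace FingerprintCode

variable {n : ℕ} {α β : Type} [Fintype α] [Nonempty α] [Fintype β] [DecidableEq β] [AddGroup β]
  (c : FingerprintCode n α β)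

/-- The quantum fingerprint of a bit string. -/
noncomputable def fingerprint (x : Fin n → Bool) : PureState (α × β) :=
  graphState (c.toFun x)

theorem norm_inner_vec_fingerprint_le {x y : Fin n → Bool} (hxy : x ≠ y) :
    ‖⟪(c.fingerprint x).vec, (c.fingerprint y).vec⟫_ℂ‖ ≤ 1 / 2 := by
  have hagree : (2 : ℝ) * Finset.card {t | c.toFun x t = c.toFun y t} ≤ Fintype.card α := by
    exact_mod_cast c.two_mul_card_agree_le x y hxy
  have hcard : (0 : ℝ) < Fintype.card α := by exact_mod_cast Fintype.card_pos
  rw [fingerprint, fingerprint, inner_vec_graphState, norm_div, Complex.norm_natCast,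
    Complex.norm_natCast, div_le_div_iff₀ hcard two_pos]
  linarith

variable {k : ℕ}

/-- The product of the fingerprints of the inputs of the `k` players. -/
noncomputable def jointFingerprint (x : Fin k → Fin n → Bool) : PureState (Fin k → α × β) :=
  .tensor fun v => c.fingerprint (x v)

/-- The permutation of the computational basis that adds the mask `y v` to the bit string
fingerprinted in the register `v`. -/
def maskShift (y : Fin k → Fin n → Bool) : Equiv.Perm (Fin k → α × β) :=
  .piCongrRight fun v => graphShift (c.toFun (y v))

theorem jointFingerprint_reindex_maskShift (x y : Fin k → Fin n → Bool) :
    (c.jointFingerprint x).reindex (c.maskShift y) =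
      c.jointFingerprint fun v => bitXor (x v) (y v) := by
  have hslot : ∀ v, c.fingerprint (bitXor (x v) (y v)) =
      (c.fingerprint (x v)).reindex (graphShift (c.toFun (y v))) := by
    intro v
    rw [fingerprint, fingerprint, graphState_reindex_graphShift, c.map_bitXor]
  simp only [jointFingerprint, hslot]
  rfl

variable [DecidableEq α]

open Classical in
/-- The test for a query on `r` copies of the joint fingerprint: the registers `i` and `j` of every
copy are masked, swap-tested, and unmasked. A query with `i = j` does not depend on the inputs. -/
noncomputable def equalityTest (r : ℕ) (Q : MEQQuery k n) :
    Matrix (Fin r → Fin k → α × β) (Fin r → Fin k → α × β) ℂ :=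
  if Q.i = Q.j then if Q.y = Q.z then 1 else 0
  else
    let V := c.maskShift fun v => if v = Q.i then Q.y else Q.z
    tensorMatrix fun _ => swapTest (V * slotSwap (α × β) Q.i Q.j * V⁻¹)

omit [Nonempty α] in
theorem isStarProjection_equalityTest (r : ℕ) (Q : MEQQuery k n) :
    IsStarProjection (c.equalityTest r Q) := by
  rw [equalityTest]
  split_ifs
  · exact .one _
  · exact .zero _
  · refine isStarProjection_tensorMatrix fun _ => isStarProjection_swapTest ?_
    rw [← sq, conj_pow, sq, slotSwap_mul_self, mul_one, mul_inv_cancel]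

theorem norm_sq_equalityTest (r : ℕ) {Q : MEQQuery k n} (hQ : Q.i ≠ Q.j)
    (x : Fin k → Fin n → Bool) :
    ‖Matrix.toEuclideanCLM (𝕜 := ℂ) (c.equalityTest r Q)
        (PureState.tensor fun _ => c.jointFingerprint x).vec‖ ^ 2 =
      ((1 + ‖⟪(c.fingerprint (bitXor (x Q.i) Q.y)).vec,
        (c.fingerprint (bitXor (x Q.j) Q.z)).vec⟫_ℂ‖ ^ 2) / 2) ^ r := by
  rw [equalityTest, if_neg hQ, norm_sq_tensorMatrix_swapTest, PureState.inner_vec_reindex_conj,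
    jointFingerprint_reindex_maskShift, jointFingerprint, PureState.inner_vec_reindex_slotSwap _ hQ,
    if_pos rfl, if_neg hQ.symm]
  norm_cast

theorem norm_equalityTest_sub_le (r : ℕ) (Q : MEQQuery k n) (x : Fin k → Fin n → Bool) :
    ‖Matrix.toEuclideanCLM (𝕜 := ℂ) (c.equalityTest r Q)
        (PureState.tensor fun _ => c.jointFingerprint x).vec -
      if Q.Holds x then (PureState.tensor fun _ => c.jointFingerprint x).vec else 0‖ ≤
      √((5 / 8) ^ r) := by
  by_cases hij : Q.i = Q.j
  · have hQ : Q.Holds x ↔ Q.y = Q.z := by simp [MEQQuery.Holds, bitXor, hij, funext_iff]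
    rw [equalityTest, if_pos hij]
    split_ifs with hyz hyz <;> simp_all
  have hnorm := c.norm_sq_equalityTest r hij x
  split_ifs with hQ
  · rw [show bitXor (x Q.i) Q.y = bitXor (x Q.j) Q.z from hQ, PureState.inner_vec_self, norm_one,
      one_pow, one_add_one_eq_two, div_self two_ne_zero, one_pow,
      pow_eq_one_iff_of_nonneg (norm_nonneg _) two_ne_zero] at hnorm
    have hprojection := (c.isStarProjection_equalityTest r Q).map (Matrix.toEuclideanCLM (𝕜 := ℂ))
    rw [apply_eq_self_of_norm_apply_eq hprojection (hnorm.trans (PureState.norm_vec _).symm),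
      sub_self, norm_zero]
    exact Real.sqrt_nonneg _
  · rw [sub_zero]
    refine Real.le_sqrt_of_sq_le (hnorm.trans_le ?_)
    have hoverlap := pow_le_pow_left₀ (norm_nonneg _) (c.norm_inner_vec_fingerprint_le hQ) 2
    exact pow_le_pow_left₀ (by positivity) (by linarith) r

end FingerprintCode

open Polynomial in
/-- The Reed–Solomon code: a bit string is the coefficient vector of a polynomial, evaluated at all
points of the field. Characteristic 2 makes it additive with respect to `bitXor`. -/
noncomputable def FingerprintCode.reedSolomon (n : ℕ) (F : Type) [Field F] [Fintype F]
    [DecidableEq F] [CharP F 2] (hn : 2 * n ≤ Fintype.card F) : FingerprintCode n F F where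
  toFun x t := (ofFn n fun u => if x u then (1 : F) else 0).eval t
  map_bitXor x y := by
    have hbit : (fun u => if bitXor x y u then (1 : F) else 0) =
        (fun u => if x u then 1 else 0) + fun u => if y u then 1 else 0 := by
      funext u
      cases hx : x u <;> cases hy : y u <;>
        simp [bitXor, hx, hy, CharTwo.add_self_eq_zero]
    funext t
    rw [hbit, map_add, eval_add, Pi.add_apply]
  two_mul_card_agree_le x y hxy := by
    refine (Nat.mul_le_mul_left 2 (not_lt.1 fun hlt => hxy ?_)).trans hn
    have hdegree (v : Fin n → F) := (ofFn_degree_lt v).trans (Nat.cast_lt.2 hlt)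
    have hpoly := injective_ofFn n (eq_of_degrees_lt_of_eval_finset_eq _ (hdegree _) (hdegree _)
      fun t ht => (Finset.mem_filter.1 ht).2)
    funext u
    have hbit : (if x u then (1 : F) else 0) = if y u then 1 else 0 := congrFun hpoly u
    cases hx : x u <;> cases hy : y u <;> simp_all

/-! ### Protocols from decision trees -/

/-- The regrouping of `k` messages of `r` registers each, encoded by `e`, into `r` copies of a
family of `k` registers. -/
def regroup {k r : ℕ} {d d' : Type} (e : d' ≃ (Fin r → d)) : (Fin k → d') ≃ (Fin r → Fin k → d) :=
  (Equiv.piCongrRight fun _ => e).trans (Equiv.piComm fun _ _ => d)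

theorem PureState.tensor_reindex_tensor {k r : ℕ} {d d' : Type} [Fintype d] [Fintype d']
    (e : d' ≃ (Fin r → d)) (φ : Fin k → PureState d) :
    (tensor fun v => (tensor fun _ : Fin r => φ v).reindex e) =
      (tensor fun _ => tensor φ).reindex (regroup e) := by
  rw [tensor, reindex, PureState.mk.injEq]
  funext a
  change ∏ v, ∏ i, (φ v).amp (e (a v) i) = ∏ i, ∏ v, (φ v).amp (e (a v) i)
  exact Finset.prod_comm

namespace FingerprintCode

variable {n k r q : ℕ} {S α β : Type} [Fintype α] [Nonempty α] [DecidableEq α] [Fintype β]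
  [DecidableEq β] [AddGroup β] (c : FingerprintCode n α β) (T : MEQTree k n S)
  (e : Fin (2 ^ q) ≃ (Fin r → α × β))

/-- The protocol in which every player sends `r` copies of the fingerprint of its input, encoded
into `q` qubits by `e`, and the referee runs the decision tree `T`. -/
noncomputable def treeProtocol : QuantumSMP k (Fin n → Bool) S where
  qubits _ := q
  message _ x := (PureState.tensor fun _ => c.fingerprint x).reindex e
  numOutcomes := Fintype.card T.Leaf
  measurement := (T.measurement (c.isStarProjection_equalityTest r)).reindex (regroup e)
    (Fintype.equivFin T.Leaf).symm
  output ω := T.label ((Fintype.equivFin T.Leaf).symm ω)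

theorem le_outputProb_treeProtocol (hr : T.depth * √((5 / 8) ^ r) ≤ 1)
    (x : Fin k → Fin n → Bool) :
    (1 - T.depth * √((5 / 8) ^ r)) ^ 2 ≤ (c.treeProtocol T e).outputProb x (T.eval x) := by
  let ω := Fintype.equivFin T.Leaf (T.leafAt x)
  have hω : (Fintype.equivFin T.Leaf).symm ω = T.leafAt x := Equiv.symm_apply_apply _ _
  let M := T.measurement (c.isStarProjection_equalityTest r)
  calc (1 - T.depth * √((5 / 8) ^ r)) ^ 2
      ≤ M.prob (.tensor fun _ => c.jointFingerprint x) (T.leafAt x) :=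
        T.le_prob_measurement_leafAt _ (fun Q => c.norm_equalityTest_sub_le r Q x) hr
    _ = (M.reindex (regroup e) (Fintype.equivFin T.Leaf).symm).prob
          ((PureState.tensor fun _ => c.jointFingerprint x).reindex (regroup e)) ω := by
        rw [Measurement.prob_reindex, hω]
    _ ≤ (c.treeProtocol T e).outputProb x (T.label ((Fintype.equivFin T.Leaf).symm ω)) := by
        rw [jointFingerprint, ← PureState.tensor_reindex_tensor]
        exact (c.treeProtocol T e).prob_le_outputProb x ω
    _ = (c.treeProtocol T e).outputProb x (T.eval x) := by rw [hω, T.label_leafAt]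

end FingerprintCode

theorem mul_sqrt_five_eighths_pow_le {D s : ℕ} (hs : 6 * D ≤ 2 ^ s) :
    D * √((5 / 8) ^ (3 * s)) ≤ 1 / 6 := by
  have hsqrt : √((5 / 8) ^ (3 * s)) ≤ (1 / 2) ^ s := by
    rw [Real.sqrt_le_left (by positivity), ← pow_mul, mul_comm s 2, pow_mul, pow_mul]
    exact pow_le_pow_left₀ (by norm_num) (by norm_num) s
  have hs : (6 * D : ℝ) ≤ 2 ^ s := by exact_mod_cast hs
  calc D * √((5 / 8) ^ (3 * s)) ≤ 2 ^ s / 6 * (1 / 2) ^ s := by gcongr; linarith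
    _ = 1 / 6 := by rw [div_mul_eq_mul_div, ← mul_pow]; norm_num

theorem MEQTree.exists_quantumSMP {k n : ℕ} {S : Type} (T : MEQTree k n S) :
    ∃ P : QuantumSMP k (Fin n → Bool) S,
      P.cost = 6 * k * Nat.clog 2 (6 * T.depth) * (Nat.clog 2 n + 1) ∧
      ∀ x, 2 / 3 ≤ P.outputProb x (T.eval x) := by
  classical
  let s := Nat.clog 2 (6 * T.depth)
  let m := Nat.clog 2 n + 1
  let F := GaloisField 2 m
  have : Fintype F := Fintype.ofFinite F
  have hcard : Fintype.card F = 2 ^ m := by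
    rw [← Nat.card_eq_fintype_card, GaloisField.card 2 m (Nat.succ_ne_zero _)]
  have hn : 2 * n ≤ Fintype.card F := by
    rw [hcard, pow_succ, mul_comm]
    exact Nat.mul_le_mul_right 2 (Nat.le_pow_clog one_lt_two n)
  obtain ⟨e⟩ : Nonempty (Fin (2 ^ (6 * s * m)) ≃ (Fin (3 * s) → F × F)) := by
    rw [← Fintype.card_eq]
    simp only [Fintype.card_fin, Fintype.card_fun, Fintype.card_prod, hcard, ← pow_add, ← pow_mul]
    congr 1
    ring
  refine ⟨(FingerprintCode.reedSolomon n F hn).treeProtocol T e, ?_, fun x => ?_⟩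
  · simp only [QuantumSMP.cost, FingerprintCode.treeProtocol, Finset.sum_const, Finset.card_univ,
      Fintype.card_fin, smul_eq_mul, s, m]
    ring
  · have herror := mul_sqrt_five_eighths_pow_le (Nat.le_pow_clog one_lt_two (6 * T.depth))
    calc (2 / 3 : ℝ) ≤ (1 - 1 / 6) ^ 2 := by norm_num
      _ ≤ (1 - T.depth * √((5 / 8) ^ (3 * s))) ^ 2 := by gcongr
      _ ≤ _ := FingerprintCode.le_outputProb_treeProtocol _ T e (by linarith) x

/-! ### Communication cost -/

theorem natCast_clog_two_le (k : ℕ) : (Nat.clog 2 k : ℝ) ≤ 3 * Real.log k := by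
  rcases lt_or_ge k 2 with hk | hk
  · simp [Nat.clog_of_right_le_one (Nat.lt_succ_iff.1 hk), Real.log_natCast_nonneg]
  have hlog_two : Real.log 2 ≤ Real.log k := Real.log_le_log two_pos (by exact_mod_cast hk)
  have hceil : (Nat.clog 2 k : ℝ) < Real.log k / Real.log 2 + 1 := by
    rw [← Real.natCeil_logb_natCast]
    exact Nat.ceil_lt_add_one (div_nonneg (Real.log_natCast_nonneg k) (Real.log_nonneg one_le_two))
  have hhalf : 2 / 3 < Real.log 2 := by linarith [Real.log_two_gt_d9]
  have hlog_pos : 0 < Real.log 2 := by linarith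
  calc (Nat.clog 2 k : ℝ) ≤ Real.log k / Real.log 2 + 1 := hceil.le
    _ ≤ Real.log k / Real.log 2 + Real.log k / Real.log 2 := by
        gcongr
        exact (one_le_div hlog_pos).2 hlog_two
    _ = 2 / Real.log 2 * Real.log k := by ring
    _ ≤ 3 * Real.log k := by
        gcongr
        rw [div_le_iff₀ hlog_pos]
        linarith

theorem clog_two_mul_clog_two_le (k : ℕ) :
    Nat.clog 2 (6 * (2 * k.choose 2)) * (Nat.clog 2 k + 1) ≤ 10 * Nat.clog 2 k ^ 2 := by
  rcases lt_or_ge k 2 with hk | hk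
  · simp [Nat.choose_eq_zero_of_lt hk]
  have hclog_pos : 1 ≤ Nat.clog 2 k := Nat.clog_pos one_lt_two hk
  have hclog : Nat.clog 2 (6 * (2 * k.choose 2)) ≤ 5 * Nat.clog 2 k := by
    refine Nat.clog_le_of_le_pow ?_
    calc 6 * (2 * k.choose 2) = 6 * (k * (k - 1)) := by rw [two_mul_choose_two]
      _ ≤ 2 ^ 3 * (k * k) := by gcongr <;> omega
      _ ≤ k ^ 3 * (k * k) := by gcongr
      _ = k ^ 5 := by ring
      _ ≤ (2 ^ Nat.clog 2 k) ^ 5 := by gcongr; exact Nat.le_pow_clog one_lt_two k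
      _ = 2 ^ (5 * Nat.clog 2 k) := by rw [← pow_mul, mul_comm]
  calc Nat.clog 2 (6 * (2 * k.choose 2)) * (Nat.clog 2 k + 1)
      ≤ 5 * Nat.clog 2 k * (Nat.clog 2 k + Nat.clog 2 k) := by gcongr
    _ = 10 * Nat.clog 2 k ^ 2 := by ring

theorem natCast_cost_le (k : ℕ) :
    ((6 * k * Nat.clog 2 (6 * (2 * k.choose 2)) * (Nat.clog 2 k + 1) : ℕ) : ℝ) ≤
      540 * k * Real.log k ^ 2 := by
  calc ((6 * k * Nat.clog 2 (6 * (2 * k.choose 2)) * (Nat.clog 2 k + 1) : ℕ) : ℝ)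
      ≤ ((6 * k * (10 * Nat.clog 2 k ^ 2) : ℕ) : ℝ) := by
        rw [mul_assoc (6 * k)]
        exact_mod_cast Nat.mul_le_mul_left (6 * k) (clog_two_mul_clog_two_le k)
    _ = 60 * k * (Nat.clog 2 k : ℝ) ^ 2 := by push_cast; ring
    _ ≤ 60 * k * (3 * Real.log k) ^ 2 := by gcongr; exact natCast_clog_two_le k
    _ = 540 * k * Real.log k ^ 2 := by ring

end QNIH
theorem mainTheorem6 :
    (∀ (k : ℕ) (G : SimpleGraph (Fin k)) (v w : Fin k), v ≠ w →
      (QNIH.FalseTwins G v w ↔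
        QNIH.MEQQuery.Holds ⟨v, w, QNIH.zeroStr k, QNIH.zeroStr k⟩ (QNIH.nu G)) ∧
      (QNIH.TrueTwins G v w ↔
        QNIH.MEQQuery.Holds ⟨v, w, QNIH.unitStr v, QNIH.unitStr w⟩ (QNIH.nu G))) ∧
    ∃ C : ℝ, 0 < C ∧ ∀ k : ℕ,
      ∃ (T : QNIH.MEQTree k k ℕ) (P : QNIH.NIHProtocol k ℕ),
        T.depth = 2 * k.choose 2 ∧
        (∀ Q ∈ T.queries, Q.i ≠ Q.j ∧
          ((Q.y = QNIH.zeroStr k ∧ Q.z = QNIH.zeroStr k) ∨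
            (Q.y = QNIH.unitStr Q.i ∧ Q.z = QNIH.unitStr Q.j))) ∧
        (∀ G : SimpleGraph (Fin k), T.eval (QNIH.nu G) = QNIH.neighborhoodDiversity G) ∧
        P.ComputesBoundedError QNIH.neighborhoodDiversity ∧
        (P.cost : ℝ) ≤ C * (k : ℝ) * Real.log (k : ℝ) ^ 2 := by
  refine ⟨fun k G v w hvw => ⟨QNIH.falseTwins_iff_holds G, QNIH.trueTwins_iff_holds G hvw⟩,
    540, by norm_num, fun k => ?_⟩
  obtain ⟨T, hdepth, hqueries, heval⟩ := QNIH.exists_tree_neighborhoodDiversity k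
  obtain ⟨P, hcost, hprob⟩ := T.exists_quantumSMP
  refine ⟨T, P, hdepth, hqueries, heval, fun G => heval G ▸ hprob (QNIH.nu G), ?_⟩
  rw [hcost, hdepth]
  exact QNIH.natCast_cost_le k
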